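/- Let $p\ge 3$. A rooted \emph{blossoming forest} of perimeter $p$ is a finite connected planar map $F$ with exactly two faces, rooted at a corner $\xi$, such that the boundary of the root face (the face containing $\xi$) is a simple cycle of length $p$, every vertex of degree greater than one which is not on the root face is adjacent to exactly two vertices of degree one, and exactly $p-3$ vertices of degree one are adjacent to a vertex on the root face. The vertices of degree one are called blossoms and their edges stems; the other vertices and edges are called proper. We draw $F$ in the plane with its non-root face unbounded. A \emph{local closure} applies to a stem $\{b,u\}$ ($b$ a blossom) which is followed, in the clockwise contour exploration of the unbounded face, by two proper edges $\{u,v\}$, $\{v,w\}$: it replaces the blossom and its stem by a new edge $\{u,w\}$ (from then on a proper edge), drawn so that the unbounded face lies to the left of $\overrightarrow{uw}$. The \emph{closure} $M$ of $F$ is the map obtained when local closures have been performed until no more is possible. The vertices of $M$ are identified with the proper vertices of $F$, and the edges of $M$ with the edges of $F$. Orient the edges on the root face so that they form a clockwise cycle, every other proper edge of $F$ towards the root-face cycle (from child to parent), and every stem towards its blossom; let $\overrightarrow O$ be the resulting orientation of $M$ (each new edge $\{u,w\}$ being oriented from $u$ to $w$). Let $\xi(0),\dots,\xi(N-1)$ be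 the corners of $F$ not incident to the root face, in the order of the clockwise contour exploration starting from the corner $\xi(0)=\xi^\dagger$ which follows $\xi$ in clockwise order around its vertex; at the end of the exploration add one more corner $\xi(N)=\xi^\circ$, a copy of $\xi^\dagger$. Put $\lambda(\xi(0))=0$, and let $\lambda(\xi(i+1))-\lambda(\xi(i))$ be $-1$ if neither $\xi(i)$ nor $\xi(i+1)$ is incident to a blossom, $0$ if only $\xi(i+1)$ is, and $+1$ if only $\xi(i)$ is (so that $\lambda(\xi^\circ)=-3$). For a proper vertex $v$ let $X(v)$ be the minimum of the labels of the corners among $\xi(0),\dots,\xi(N-1)$ incident to $v$ (so $\xi^\circ$ is not considered). For $\overrightarrow{uu'}\in\overrightarrow O$ let $\kappa^\ell(uu')$ be the corner of $F$ at $u$ situated just before the corresponding edge of $F$ in clockwise direction around $u$, and put $\lambda^\ell(uu')=\lambda(\kappa^\ell(uu'))$. For $\overrightarrow{uu'},\overrightarrow{vv'}\in\overrightarrow O$ with $\kappa^\ell(uu')=\xi(i)$ and $\kappa^\ell(vv')=\xi(j)$, $0\le i,j<N$, let $\check X(uu',vv')$ be the minimum of $\lambda(\xi(k))$ over $i\le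 k\le j$ if $i\le j$, and over $i\le k\le N$ and $0\le k\le j$ if $j<i$. Let $u,v$ be two vertices of $M$ and let $\overrightarrow{uu'},\overrightarrow{vv'}\in\overrightarrow O$ be such that $\lambda^\ell(uu')=X(u)$ and $\lambda^\ell(vv')=X(v)$. Then the graph distance $d_M$ in $M$ satisfies $$d_M(u,v)\le X(u)+X(v)-2\max\{\check X(uu',vv'),\check X(vv',uu')\}+6 .$$ -/

import Mathlib

/-- A finite combinatorial map on a set `D` of darts (directed edges).
`opp` reverses a dart; `rot d` is the next dart after `d` in clockwise direction around the
vertex from which `d` emanates.  The corner situated just before `d` in clockwise direction around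
the tail of `d` (written `κ^ℓ(d)`) is identified with the dart `d`. -/
@[ext]
structure CombMap (D : Type*) where
  rot : Equiv.Perm D
  opp : Equiv.Perm D
  opp_opp : ∀ d, opp (opp d) = d
  opp_ne : ∀ d, opp d ≠ d

namespace CombMap

variable {D : Type*}

/-- The contour permutation: follow `d` to its head, then leave along the next dart in clockwise
direction.  This goes around the face which lies to the left of `d`, from the corner `κ^ℓ(d)` to
the next corner of that face. -/
def next (m : CombMap D) : Equiv.Perm D := m.rot * m.opp

/-- Vertices are the orbits of `rot`. -/
def Vertex (m : CombMap D) : Type _ := Quotient (Equiv.Perm.SameCycle.setoid m.rot)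

/-- Edges are the orbits of `opp`. -/
def Edge (m : CombMap D) : Type _ := Quotient (Equiv.Perm.SameCycle.setoid m.opp)

/-- Faces are the orbits of `next`. -/
def Face (m : CombMap D) : Type _ := Quotient (Equiv.Perm.SameCycle.setoid m.next)

/-- The tail of a dart, which is also the vertex incident to the corner `κ^ℓ(d)`. -/
def vert (m : CombMap D) (d : D) : m.Vertex :=
  Quotient.mk (Equiv.Perm.SameCycle.setoid m.rot) d

/-- The face to the left of a dart, which is also the face incident to the corner `κ^ℓ(d)`. -/
def face (m : CombMap D) (d : D) : m.Face :=
  Quotient.mk (Equiv.Perm.SameCycle.setoid m.next) d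

/-- The underlying graph. Loops and multiplicities, which do not affect graph distances, are
forgotten. -/
def graph (m : CombMap D) : SimpleGraph m.Vertex :=
  SimpleGraph.fromRel fun u v => ∃ d, m.vert d = u ∧ m.vert (m.opp d) = v

/-- A planar map: connected and of genus zero (Euler's formula). -/
structure IsPlanarMap (m : CombMap D) : Prop where
  connected : m.graph.Connected
  euler : Nat.card m.Vertex + Nat.card m.Face = Nat.card m.Edge + 2

/-- The tail of `d` has degree one (it is a blossom, if the map is a blossoming forest). Such a
vertex is represented by its unique outgoing dart. -/
def IsBlossom (m : CombMap D) (d : D) : Prop := m.rot d = d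

/-- The vertex `v` is incident to the root face, the face of the root corner `κ^ℓ(r)`. -/
def OnRootFace (m : CombMap D) (r : D) (v : m.Vertex) : Prop :=
  ∃ d, m.face d = m.face r ∧ m.vert d = v

/-- A rooted cyclic forest of perimeter `p` with root corner `κ^ℓ(r)`: a planar map with two faces
in which the boundary of the root face is a simple cycle of length `p`. -/
structure IsCyclicForest (F : CombMap D) (r : D) (p : ℕ) : Prop where
  planar : F.IsPlanarMap
  two_faces : Nat.card F.Face = 2
  simple_boundary : ∀ d d', F.face d = F.face r → F.face d' = F.face r →
    F.vert d = F.vert d' → d = d'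
  perimeter : Nat.card {d // F.face d = F.face r} = p

/-- A rooted blossoming forest of perimeter `p`: every inner vertex of degree greater than one is
adjacent to exactly two vertices of degree one, and there are exactly `p - 3` vertices of degree
one whose unique neighbour is incident to the root face. (Vertices of degree one are counted by
their unique outgoing darts, or by the reverses of these.) -/
structure IsBlossomingForest (F : CombMap D) (r : D) (p : ℕ) : Prop where
  three_le : 3 ≤ p
  forest : F.IsCyclicForest r p
  inner_stems : ∀ d, ¬ F.IsBlossom d → ¬ F.OnRootFace r (F.vert d) →
    Nat.card {s // F.vert s = F.vert d ∧ F.IsBlossom (F.opp s)} = 2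
  root_stems :
    Nat.card {b // F.IsBlossom b ∧ F.OnRootFace r (F.vert (F.opp b))} = p - 3

/-- An edge is proper if neither of its ends is a blossom. -/
def IsProperEdge (m : CombMap D) (d : D) : Prop := ¬ m.IsBlossom d ∧ ¬ m.IsBlossom (m.opp d)

/-- Move the end `b` of an edge into the corner `κ^ℓ(next e)` at the head of `e`: around that
vertex, `b` comes just after `opp e` and just before `next e`. -/
def attach [DecidableEq D] (m : CombMap D) (b e : D) : CombMap D where
  rot := m.rot * Equiv.swap b (m.opp e)
  opp := m.opp
  opp_opp := m.opp_opp
  opp_ne := m.opp_ne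

/-- A local closure. Let `b` be the dart leaving a blossom, towards the vertex `u`. After the visit
of the blossom, the clockwise contour follows the dart `next b` from `u` to `v`, and then the dart
`next (next b)` from `v` to `w`. If both edges are proper, the stem is replaced by an edge from `u`
to `w`, which closes the triangle `u v w` and leaves the contoured face to the left of the
dart from `u` to `w`. The darts of the stem become the darts of the new edge. -/
def LocalClosure [DecidableEq D] (m m' : CombMap D) : Prop :=
  ∃ b, m.IsBlossom b ∧ m.IsProperEdge (m.next b) ∧ m.IsProperEdge (m.next (m.next b)) ∧
    m' = m.attach b (m.next (m.next b))

/-- `M` is obtained from `F` by performing local closures until no more is possible. -/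
def IsClosure [DecidableEq D] (F M : CombMap D) : Prop :=
  Relation.ReflTransGen LocalClosure F M ∧ ∀ M', ¬ LocalClosure M M'

/-- Each local closure removes one vertex of degree one, so that every map has a closure. -/
theorem exists_isClosure [Finite D] [DecidableEq D] (F : CombMap D) : ∃ M, F.IsClosure M := by
  classical
  have key : ∀ n : ℕ, ∀ m : CombMap D, {d | m.IsBlossom d}.ncard = n → ∃ M, m.IsClosure M := by
    intro n
    induction n using Nat.strong_induction_on with
    | _ n ih =>
      intro m hm
      by_cases h : ∃ m', LocalClosure m m'
      · obtain ⟨m', hs⟩ := h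
        have hlt : {d | m'.IsBlossom d}.ncard < n := by
          rw [← hm]
          refine Set.ncard_lt_ncard ?_ (Set.toFinite _)
          obtain ⟨b, hb, -, ⟨-, h2⟩, rfl⟩ := hs
          simp only [IsBlossom] at hb h2
          have hnb : ¬ (m.attach b (m.next (m.next b))).IsBlossom b := by
            intro hc
            simp only [IsBlossom, attach, Equiv.Perm.mul_apply, Equiv.swap_apply_left] at hc
            exact h2 (by rw [hc]; exact m.rot.injective (by rw [hc, hb]))
          refine ⟨fun d hd => ?_, fun hsub => hnb (hsub hb)⟩
          simp only [Set.mem_ofPred_eq, IsBlossom, attach, Equiv.Perm.mul_apply] at hd ⊢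
          rw [Equiv.swap_apply_def] at hd
          split_ifs at hd with h3 h4
          · rw [h3]; exact hb
          · rw [hb] at hd
            exact absurd (h4.symm.trans hd.symm) (fun hc => h2 (by rw [hc]; exact hb))
          · exact hd
        obtain ⟨M, hM, hM'⟩ := ih _ hlt m' rfl
        exact ⟨M, Relation.ReflTransGen.head hs hM, hM'⟩
      · exact ⟨m, Relation.ReflTransGen.refl, fun M' hM' => h ⟨M', hM'⟩⟩
  exact key _ F rfl

/-- The generation of a vertex of a cyclic forest: its distance to the cycle bounding the root face,
i.e. to the root of the tree to which it belongs. -/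
noncomputable def generation (F : CombMap D) (r : D) (v : F.Vertex) : ℕ :=
  sInf {n | ∃ w, F.OnRootFace r w ∧ F.graph.dist v w = n}

/-- The orientation of a blossoming forest, as a predicate on darts. The edges on the root face form
a clockwise cycle (the root face lies to their right), the other proper edges point to the
parent, and the stems point to their blossom. The closure has the same darts as the forest, and it
is oriented by the same predicate: a closure-edge, from `u` to `w`, is oriented as
its stem was. -/
def Oriented (F : CombMap D) (r : D) (d : D) : Prop :=
  F.face (F.opp d) = F.face r ∨
  (F.face d ≠ F.face r ∧ F.face (F.opp d) ≠ F.face r ∧ F.IsProperEdge d ∧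
    F.generation r (F.vert (F.opp d)) + 1 = F.generation r (F.vert d)) ∨
  F.IsBlossom (F.opp d)

/-- The `i`-th corner `ξ(i)` of the clockwise contour of the non-root face, which starts at the
corner `ξ(0) = ξ†` that follows the root corner in clockwise direction. -/
def contour (F : CombMap D) (r : D) (i : ℕ) : D := (F.next ^ i) (F.rot r)

/-- The number of corners not incident to the root face. -/
noncomputable def contourLength (F : CombMap D) (r : D) : ℕ :=
  Nat.card {d // F.face d ≠ F.face r}

open Classical in
/-- The labels along the contour. The labels with index less than `contourLength` are those of the
corners; the label with index `contourLength` (which is `-3`) is that of the last corner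
`ξ°`, the additional copy of the first corner `ξ†`. Two blossoms never follow each other in
a blossoming forest. -/
noncomputable def contourLabel (F : CombMap D) (r : D) : ℕ → ℤ
  | 0 => 0
  | i + 1 =>
    if F.IsBlossom (F.contour r i) then F.contourLabel r i + 1
    else if F.IsBlossom (F.contour r (i + 1)) then F.contourLabel r i
    else F.contourLabel r i - 1

/-- The index of a corner in the contour. -/
noncomputable def position (F : CombMap D) (r : D) (d : D) : ℕ :=
  sInf {i | F.contour r i = d}

/-- The label `λ^ℓ(d)` of the corner `κ^ℓ(d)`. -/
noncomputable def cornerLabel (F : CombMap D) (r : D) (d : D) : ℤ :=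
  F.contourLabel r (F.position r d)

/-- The label `X(v)`: the least label of the corners at `v` that are not on the root face. The
additional corner `ξ°` is not taken into account. -/
noncomputable def vertexLabel (F : CombMap D) (r : D) (v : F.Vertex) : ℤ :=
  sInf {l | ∃ d, F.vert d = v ∧ F.face d ≠ F.face r ∧ F.cornerLabel r d = l}

/-- The cyclic interval of contour indices from the corner `κ^ℓ(e)` to the corner `κ^ℓ(f)`; if it
passes the end of the contour, it contains `ξ°` and `ξ†`. -/
def cyclicInterval (F : CombMap D) (r : D) (e f : D) : Set ℕ :=
  {i | (F.position r e ≤ F.position r f ∧ F.position r e ≤ i ∧ i ≤ F.position r f) ∨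
    (F.position r f < F.position r e ∧
      (i ≤ F.position r f ∨ (F.position r e ≤ i ∧ i ≤ F.contourLength r)))}

/-- `X̌(e, f)`: the minimal label in the cyclic interval from `κ^ℓ(e)` to `κ^ℓ(f)`. -/
noncomputable def minLabel (F : CombMap D) (r : D) (e f : D) : ℤ :=
  sInf (F.contourLabel r '' F.cyclicInterval r e f)

end CombMap

/-!
The darts of the contoured face of `F`, in the order of the contour, carry labels that go down by
one along a proper edge and up by one along a stem. A local closure moves the end of a stem issued
from a corner of label `l` to the corner that follows the next two proper edges; what is preserved through all local closures is
that the new edge leads to the *first* later corner of label `l - 1`, and that the edges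
left on the contour, old or new, have the same property. This is the invariant `PartialClosure`.

By Euler's formula there are three more proper sides than stems on the contour
(`IsBlossomingForest.card_isBlossom`), so that the labels, continued periodically, drop by three
in each turn and tend to `-∞`. This forces all the stems to be closed in the end
(`PartialClosure.not_isBlossom`). In the closure every proper corner of label `l` is therefore
joined by an edge to the first later corner of label `l - 1`. Iterating, a path of `l - h` edges
leads from a corner of label `l` to the first later corner of label `h`
(`PartialClosure.exists_descent`).

Let `m` be the minimum of the labels between two corners of labels `a` and `b`. The descending
paths from both of them arrive at the same corner of label `m - 1`, the first one after both of
them, whence a path of length `a + b - 2 * m + 2` (`PartialClosure.dist_le`). If the interval passes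
the end of the contour, the labels of its second part have to be shifted by `-3`: then `b` decreases
by `3` and `m` by at most `3`, and the bound becomes `a + b - 2 * m + 5`.
-/

namespace CombMap

variable {D : Type*}

/-! ### Contours and blossoms -/

/-- `k'` is the first index after `k` at which the label is one less than at `k`, all the labels in
between being at least that of `k`. -/
structure FirstDrop (L : ℕ → ℤ) (k k' : ℕ) : Prop where
  lt : k < k'
  label_eq : L k' = L k - 1
  le_label : ∀ j, k < j → j < k' → L k ≤ L j

theorem next_apply (m : CombMap D) (d : D) : m.next d = m.rot (m.opp d) := rfl

theorem vert_eq_iff {m : CombMap D} {d d' : D} :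
    m.vert d = m.vert d' ↔ m.rot.SameCycle d d' := Quotient.eq (r := _)

theorem face_eq_iff {m : CombMap D} {d d' : D} :
    m.face d = m.face d' ↔ m.next.SameCycle d d' := Quotient.eq (r := _)

theorem vert_rot (m : CombMap D) (d : D) : m.vert (m.rot d) = m.vert d :=
  vert_eq_iff.2 (Equiv.Perm.sameCycle_apply_left.2 (Equiv.Perm.SameCycle.refl _ _))

theorem face_next (m : CombMap D) (d : D) : m.face (m.next d) = m.face d :=
  face_eq_iff.2 (Equiv.Perm.sameCycle_apply_left.2 (Equiv.Perm.SameCycle.refl _ _))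

theorem contour_succ (F : CombMap D) (r : D) (k : ℕ) :
    F.contour r (k + 1) = F.next (F.contour r k) := by
  simp [contour, pow_succ']

theorem isBlossom_rot_iff {m : CombMap D} {d : D} : m.IsBlossom (m.rot d) ↔ m.IsBlossom d :=
  m.rot.injective.eq_iff

theorem isBlossom_next_iff {m : CombMap D} {d : D} :
    m.IsBlossom (m.next d) ↔ m.IsBlossom (m.opp d) := isBlossom_rot_iff

/-- On a stem leading to a blossom `b`, the contour turns around at the blossom. -/
theorem IsBlossom.next_opp {m : CombMap D} {b : D} (hb : m.IsBlossom b) :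
    m.next (m.opp b) = b := by
  rw [next_apply, m.opp_opp]; exact hb

theorem IsBlossom.face_opp {m : CombMap D} {b : D} (hb : m.IsBlossom b) :
    m.face (m.opp b) = m.face b := by
  rw [← face_next, hb.next_opp]

/-- A vertex of degree one has a single outgoing dart. -/
theorem IsBlossom.eq_of_vert_eq {m : CombMap D} {b d : D} (hb : m.IsBlossom b)
    (h : m.vert b = m.vert d) : b = d := by
  obtain ⟨n, hn⟩ := vert_eq_iff.1 h
  rw [← hn]; exact (Equiv.Perm.zpow_apply_eq_self_of_apply_eq_self hb n).symm

/-! ### Labels along the contour -/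

section Labels

variable {F : CombMap D} {r : D} {k : ℕ}

theorem contourLabel_succ_of_blossom (h : F.IsBlossom (F.contour r k)) :
    F.contourLabel r (k + 1) = F.contourLabel r k + 1 := by
  simp only [contourLabel, if_pos h]

theorem contourLabel_succ_of_stem (h : ¬ F.IsBlossom (F.contour r k))
    (h' : F.IsBlossom (F.opp (F.contour r k))) :
    F.contourLabel r (k + 1) = F.contourLabel r k := by
  rw [← isBlossom_next_iff, ← contour_succ] at h'
  simp only [contourLabel, if_neg h, if_pos h']

theorem contourLabel_succ_of_proper (h : F.IsProperEdge (F.contour r k)) :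
    F.contourLabel r (k + 1) = F.contourLabel r k - 1 := by
  have h' := h.2
  rw [← isBlossom_next_iff, ← contour_succ] at h'
  simp only [contourLabel, if_neg h.1, if_neg h']

open Classical in
/-- The variation of the labels along the contour when leaving the corner just before `d`. -/
noncomputable def labelStep (F : CombMap D) (d : D) : ℤ :=
  if F.IsBlossom d then 1 else if F.IsBlossom (F.opp d) then 0 else -1

theorem contourLabel_succ (F : CombMap D) (r : D) (k : ℕ) :
    F.contourLabel r (k + 1) = F.contourLabel r k + F.labelStep (F.contour r k) := by
  unfold labelStep
  split_ifs with h h'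
  · exact contourLabel_succ_of_blossom h
  · rw [contourLabel_succ_of_stem h h', add_zero]
  · exact contourLabel_succ_of_proper ⟨h, h'⟩

theorem contourLabel_sub_one_le_succ (F : CombMap D) (r : D) (k : ℕ) :
    F.contourLabel r k - 1 ≤ F.contourLabel r (k + 1) := by
  simp only [contourLabel]; split_ifs <;> omega

theorem not_isBlossom_of_contourLabel_lt
    (h : F.contourLabel r (k + 1) < F.contourLabel r k) : ¬ F.IsBlossom (F.contour r (k + 1)) := by
  intro hb
  simp only [contourLabel, if_pos hb] at h
  split_ifs at h <;> omega

theorem FirstDrop.not_isBlossom {k' : ℕ} (h : FirstDrop (F.contourLabel r) k k') :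
    ¬ F.IsBlossom (F.contour r k') := by
  obtain ⟨hlt, heq, hle⟩ := h
  obtain ⟨j, rfl⟩ : ∃ j, k' = j + 1 := ⟨k' - 1, by omega⟩
  apply not_isBlossom_of_contourLabel_lt
  rcases (Nat.lt_succ_iff.1 hlt).eq_or_lt with rfl | hj
  · omega
  · have := hle j hj (by omega)
    omega

end Labels

/-! ### Local closures -/

section Attach

variable [DecidableEq D]

theorem attach_rot_left (m : CombMap D) (b e : D) : (m.attach b e).rot b = m.next e := by
  simp [attach, next_apply]

theorem attach_next_of_ne {m : CombMap D} {b e d : D} (h : d ≠ m.opp b) (h' : d ≠ e) :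
    (m.attach b e).next d = m.next d := by
  have h1 : m.opp d ≠ b := fun hc => h (by rw [← hc, m.opp_opp])
  have h2 : m.opp d ≠ m.opp e := fun hc => h' (m.opp.injective hc)
  simp [attach, next, Equiv.swap_apply_of_ne_of_ne h1 h2]

theorem attach_next_opp (m : CombMap D) (b e : D) :
    (m.attach b e).next (m.opp b) = m.next e := by
  simp [attach, next, m.opp_opp]

theorem attach_isBlossom_iff {m : CombMap D} {b e d : D} (hb : m.IsBlossom b)
    (he : ¬ m.IsBlossom (m.opp e)) :
    (m.attach b e).IsBlossom d ↔ m.IsBlossom d ∧ d ≠ b := by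
  have hbe : b ≠ m.opp e := fun h => he (h ▸ hb)
  by_cases h1 : d = b
  · subst h1
    simp only [ne_eq, not_true_eq_false, and_false, iff_false]
    intro hc
    simp only [IsBlossom, attach, Equiv.Perm.mul_apply, Equiv.swap_apply_left] at hc
    exact hbe (m.rot.injective (hb.trans hc.symm))
  by_cases h2 : d = m.opp e
  · subst h2
    simp only [he, false_and, iff_false]
    intro hc
    simp only [IsBlossom, attach, Equiv.Perm.mul_apply, Equiv.swap_apply_right] at hc
    exact hbe (hb.symm.trans hc)
  · simp [IsBlossom, attach, Equiv.swap_apply_of_ne_of_ne h1 h2, h1]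

/-- Attaching a blossom elsewhere does not split any vertex. -/
theorem attach_sameCycle {m : CombMap D} {b e x y : D} (hb : m.IsBlossom b)
    (h : m.rot.SameCycle x y) : (m.attach b e).rot.SameCycle x y := by
  have step : ∀ z, (m.attach b e).rot.SameCycle z (m.rot z) := by
    intro z
    by_cases h1 : z = b
    · rw [h1, hb]
    by_cases h2 : z = m.opp e
    · refine ⟨2, ?_⟩
      have hb' : m.rot b = b := hb
      simp [attach, pow_two, h2, hb']
    · refine ⟨1, ?_⟩
      simp [attach, Equiv.swap_apply_of_ne_of_ne h1 h2]
  have hn : ∀ (n : ℕ) z, (m.attach b e).rot.SameCycle z ((m.rot ^ n) z) := by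
    intro n
    induction n with
    | zero => intro z; exact .refl _ _
    | succ n ih => intro z; rw [pow_succ', Equiv.Perm.mul_apply]; exact (ih z).trans (step _)
  obtain ⟨n, rfl⟩ := h
  obtain ⟨n, rfl | rfl⟩ := n.eq_nat_or_neg
  · exact hn n x
  · have := hn n ((m.rot ^ (-(n : ℤ))) x)
    rw [← zpow_natCast, ← Equiv.Perm.mul_apply, ← zpow_add] at this
    simpa using this.symm

end Attach

/-- The state of the map `m` after some local closures in `F`. The set `A` consists of the darts
still on the contoured face, which is all of the contour of `F` at the start. Along `A`, the map
`m` has its own contour, and the labels inherited from `F` still go up by one along a stem and down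
by one along the other edges; moreover such an edge leads to the first later corner of
the contour of `F` whose label is one less. The last field records where the closed stems go. -/
structure PartialClosure (F : CombMap D) (r : D) (m : CombMap D) (A : Set D) : Prop where
  opp_eq : m.opp = F.opp
  sameCycle : ∀ x y, F.rot.SameCycle x y → m.rot.SameCycle x y
  isBlossom : ∀ b, m.IsBlossom b → F.IsBlossom b
  exists_contour : ∀ d ∈ A, ∃ k, F.contour r k = d
  mem : ∀ b, m.IsBlossom b → b ∈ A ∧ m.opp b ∈ A
  next_mem : ∀ d ∈ A, m.next d ∈ A
  next_eq : ∀ d, m.IsBlossom d ∨ m.IsBlossom (m.opp d) → m.next d = F.next d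
  next_drop : ∀ k, F.contour r k ∈ A → m.IsProperEdge (F.contour r k) →
    ∃ k', FirstDrop (F.contourLabel r) k k' ∧ m.next (F.contour r k) = F.contour r k'
  closed_stem : ∀ k, F.IsBlossom (F.opp (F.contour r k)) → ¬ m.IsBlossom (F.opp (F.contour r k)) →
    ∃ k', FirstDrop (F.contourLabel r) k k' ∧
      m.rot.SameCycle (F.opp (F.contour r k)) (F.contour r k')

section Closure

variable {F : CombMap D} {r : D}

theorem PartialClosure.refl (hr : ∀ d, F.IsBlossom d → ∃ k, F.contour r k = d)
    (hr' : ∀ d, F.IsBlossom (F.opp d) → ∃ k, F.contour r k = d) :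
    PartialClosure F r F (Set.range (F.contour r)) where
  opp_eq := rfl
  sameCycle _ _ h := h
  isBlossom _ h := h
  exists_contour _ h := h
  mem b h := ⟨hr b h, hr' _ (by rwa [F.opp_opp])⟩
  next_mem := by
    rintro _ ⟨k, rfl⟩
    exact ⟨k + 1, contour_succ F r k⟩
  next_eq _ _ := rfl
  next_drop k _ h := ⟨k + 1, ⟨by omega, contourLabel_succ_of_proper h, by omega⟩,
    (contour_succ F r k).symm⟩
  closed_stem _ h h' := absurd h h'

theorem PartialClosure.localClosure [DecidableEq D] {m m' : CombMap D} {A : Set D}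
    (hm : PartialClosure F r m A) (hF : ∀ b, F.IsBlossom b → ¬ F.IsBlossom (F.opp b))
    (h : LocalClosure m m') : ∃ A', PartialClosure F r m' A' := by
  obtain ⟨b, hb, h1, h2, rfl⟩ := h
  set e₁ := m.next b with he₁
  set e := m.next e₁ with he
  have hbl : ∀ d, (m.attach b e).IsBlossom d ↔ m.IsBlossom d ∧ d ≠ b :=
    fun d => attach_isBlossom_iff hb h2.2
  have hop : (m.attach b e).opp = m.opp := rfl
  have hbF := hm.isBlossom b hb
  have hob : ¬ m.IsBlossom (m.opp b) := fun hc =>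
    hF b hbF (hm.opp_eq ▸ hm.isBlossom _ hc)
  have hb1 : b ≠ e₁ := fun hc => h1.1 (hc ▸ hb)
  have hbe : b ≠ e := fun hc => h2.1 (hc ▸ hb)
  have hobe : m.opp b ≠ e := fun hc => h2.2 (by rw [← hc, m.opp_opp]; exact hb)
  have hob1 : m.opp b ≠ e₁ := fun hc => h1.2 (by rw [← hc, m.opp_opp]; exact hb)
  have hbA := hm.mem b hb
  have h1A := hm.next_mem _ hbA.1
  have h2A := hm.next_mem _ h1A
  have h3A := hm.next_mem _ h2A
  -- The labels of the four corners involved are `l`, `l + 1`, `l`, `l - 1`: the new edge goes to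
  -- the first later corner of label `l - 1`.
  have key : ∀ k, F.contour r k = m.opp b →
      ∃ k', FirstDrop (F.contourLabel r) k k' ∧ m.next e = F.contour r k' := by
    intro k hk
    have c1 : F.contour r (k + 1) = b := by
      rw [contour_succ, hk, hm.opp_eq, hbF.next_opp]
    have c2 : F.contour r (k + 2) = e₁ := by
      rw [contour_succ, c1, he₁, hm.next_eq b (Or.inl hb)]
    have l1 : F.contourLabel r (k + 1) = F.contourLabel r k :=
      contourLabel_succ_of_stem (by rw [hk, hm.opp_eq]; exact hF b hbF)
        (by rw [hk, hm.opp_eq, F.opp_opp]; exact hbF)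
    have l2 : F.contourLabel r (k + 2) = F.contourLabel r (k + 1) + 1 :=
      contourLabel_succ_of_blossom (by rw [c1]; exact hbF)
    obtain ⟨i, hi, hi'⟩ := hm.next_drop (k + 2) (by rw [c2]; exact h1A) (by rw [c2]; exact h1)
    rw [c2, ← he] at hi'
    obtain ⟨j, hj, hj'⟩ := hm.next_drop i (by rw [← hi']; exact h2A) (by rw [← hi']; exact h2)
    rw [← hi'] at hj'
    refine ⟨j, ⟨?_, ?_, ?_⟩, hj'⟩
    · have := hi.lt; have := hj.lt; omega
    · have := hi.label_eq; have := hj.label_eq; omega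
    · intro n hn hn'
      have e1 := hi.label_eq
      have a1 := hi.le_label n
      have a2 := hj.le_label n
      rcases lt_trichotomy n (k + 2) with hlt | rfl | hlt
      · obtain rfl : n = k + 1 := by omega
        omega
      · omega
      · rcases lt_trichotomy n i with hlt' | rfl | hlt'
        · have := a1 hlt hlt'; omega
        · omega
        · have := a2 hlt' hn'; omega
  refine ⟨A \ {b, e₁, e}, hm.opp_eq, fun x y hxy => attach_sameCycle hb (hm.sameCycle x y hxy),
    fun d hd => hm.isBlossom d ((hbl d).1 hd).1, fun d hd => hm.exists_contour d hd.1, ?_, ?_, ?_,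
    ?_, ?_⟩
  · intro d hd
    obtain ⟨hd, hdb⟩ := (hbl d).1 hd
    obtain ⟨m1, m2⟩ := hm.mem d hd
    rw [hop]
    refine ⟨⟨m1, ?_⟩, ⟨m2, ?_⟩⟩
    · rintro (rfl | rfl | rfl)
      exacts [hdb rfl, h1.1 hd, h2.1 hd]
    · rintro (hc | hc | hc)
      · exact hob (by rw [← hc, m.opp_opp]; exact hd)
      · exact h1.2 (by rw [← hc, m.opp_opp]; exact hd)
      · exact h2.2 (by rw [← hc, m.opp_opp]; exact hd)
  · rintro d ⟨hdA, hd⟩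
    simp only [Set.mem_insert_iff, Set.mem_singleton_iff, not_or] at hd
    by_cases hdb : d = m.opp b
    · subst hdb
      rw [attach_next_opp]
      refine ⟨h3A, ?_⟩
      rintro (hc | hc | hc)
      · rw [← hb.next_opp] at hc
        exact hobe (m.next.injective hc).symm
      · exact hbe (m.next.injective hc).symm
      · have h3 : e = e₁ := m.next.injective hc
        exact hb1 (m.next.injective (he₁.symm.trans (h3.symm.trans he)))
    · rw [attach_next_of_ne hdb hd.2.2]
      refine ⟨hm.next_mem d hdA, ?_⟩
      rintro (hc | hc | hc)
      · exact hdb (m.next.injective (hc.trans hb.next_opp.symm))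
      · exact hd.1 (m.next.injective hc)
      · exact hd.2.1 (m.next.injective hc)
  · intro d hd
    rw [hbl, hop, hbl] at hd
    rw [attach_next_of_ne, hm.next_eq d (hd.imp And.left And.left)]
    · rintro rfl
      rcases hd with hd | hd
      · exact hob hd.1
      · exact hd.2 (m.opp_opp b)
    · rintro rfl
      rcases hd with hd | hd
      · exact h2.1 hd.1
      · exact h2.2 hd.1
  · rintro k ⟨hkA, hk⟩ hkp
    simp only [Set.mem_insert_iff, Set.mem_singleton_iff, not_or] at hk
    rw [IsProperEdge, hop, hbl, hbl] at hkp
    by_cases hdb : F.contour r k = m.opp b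
    · obtain ⟨k', hk1, hk2⟩ := key k hdb
      exact ⟨k', hk1, by rw [hdb, attach_next_opp, hk2]⟩
    · rw [attach_next_of_ne hdb hk.2.2]
      refine hm.next_drop k hkA ⟨fun hc => hkp.1 ⟨hc, hk.1⟩, fun hc => hkp.2 ⟨hc, fun h => ?_⟩⟩
      exact hdb (by rw [← h, m.opp_opp])
  · intro k hk hk'
    rw [hbl] at hk'
    by_cases hkb : F.opp (F.contour r k) = b
    · obtain ⟨k', hk1, hk2⟩ := key k (by rw [← hkb, hm.opp_eq, F.opp_opp])
      refine ⟨k', hk1, 1, ?_⟩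
      rw [hkb, zpow_one, attach_rot_left, hk2]
    · obtain ⟨k', hk1, hk2⟩ := hm.closed_stem k hk (fun hc => hk' ⟨hc, hkb⟩)
      exact ⟨k', hk1, attach_sameCycle hb hk2⟩

theorem PartialClosure.of_reflTransGen [DecidableEq D] {M : CombMap D} {A : Set D}
    (hA : PartialClosure F r F A)
    (hF : ∀ b, F.IsBlossom b → ¬ F.IsBlossom (F.opp b))
    (hM : Relation.ReflTransGen LocalClosure F M) : ∃ A', PartialClosure F r M A' := by
  induction hM with
  | refl => exact ⟨A, hA⟩
  | tail _ h ih =>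
    obtain ⟨A', hA'⟩ := ih
    exact hA'.localClosure hF h

/-- If no local closure is possible, every stem is followed along the contour by another one whose
label is at least as large, which is impossible if the labels tend to `-∞`. -/
theorem PartialClosure.not_isBlossom [DecidableEq D] {M : CombMap D} {A : Set D}
    (hA : PartialClosure F r M A)
    (hF : ∀ b, F.IsBlossom b → ¬ F.IsBlossom (F.opp b)) (hM : ∀ M', ¬ LocalClosure M M')
    (hL : ∀ B, ∃ K, ∀ k, K ≤ k → F.contourLabel r k < B) (b : D) : ¬ M.IsBlossom b := by
  have hob : ∀ b, M.IsBlossom b → ¬ M.IsBlossom (M.opp b) := fun b hb hc =>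
    hF b (hA.isBlossom b hb) (hA.opp_eq ▸ hA.isBlossom _ hc)
  have step : ∀ k, M.IsBlossom (M.opp (F.contour r k)) → ∃ k', k < k' ∧
      F.contourLabel r k ≤ F.contourLabel r k' ∧ M.IsBlossom (M.opp (F.contour r k')) := by
    intro k hk
    have hk0 : ¬ M.IsBlossom (F.contour r k) := by
      have := hob _ hk
      rwa [M.opp_opp] at this
    have hkF := hA.isBlossom _ hk
    have hbA := (hA.mem _ hk).1
    have c1 : F.contour r (k + 1) = M.opp (F.contour r k) := by
      rw [contour_succ, hA.opp_eq]
      rw [hA.opp_eq] at hkF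
      have := hkF.next_opp
      rwa [F.opp_opp] at this
    have c2 : F.contour r (k + 2) = M.next (M.opp (F.contour r k)) := by
      rw [contour_succ, c1, hA.next_eq _ (Or.inl hk)]
    have l1 : F.contourLabel r (k + 1) = F.contourLabel r k :=
      contourLabel_succ_of_stem (fun hc => hF _ hc (hA.opp_eq ▸ hkF)) (hA.opp_eq ▸ hkF)
    have l2 : F.contourLabel r (k + 2) = F.contourLabel r (k + 1) + 1 :=
      contourLabel_succ_of_blossom (by rw [c1]; exact hkF)
    have hn2 : ¬ M.IsBlossom (F.contour r (k + 2)) := by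
      rw [c2, isBlossom_next_iff, M.opp_opp]; exact hk0
    by_cases h2 : M.IsBlossom (M.opp (F.contour r (k + 2)))
    · exact ⟨k + 2, by omega, by omega, h2⟩
    have hA2 : F.contour r (k + 2) ∈ A := by rw [c2]; exact hA.next_mem _ hbA
    obtain ⟨i, hi, hi'⟩ := hA.next_drop (k + 2) hA2 ⟨hn2, h2⟩
    refine ⟨i, by have := hi.lt; omega, by have := hi.label_eq; omega, ?_⟩
    by_contra hc
    refine hM _ ⟨M.opp (F.contour r k), hk, c2 ▸ ⟨hn2, h2⟩, ?_, rfl⟩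
    rw [← c2, hi']
    refine ⟨?_, hc⟩
    rw [← hi', isBlossom_next_iff]
    exact h2
  intro hb
  obtain ⟨k, hk⟩ := hA.exists_contour _ (hA.mem b hb).2
  have far : ∀ n, ∃ k', n ≤ k' ∧ F.contourLabel r k ≤ F.contourLabel r k' ∧
      M.IsBlossom (M.opp (F.contour r k')) := by
    intro n
    induction n with
    | zero => exact ⟨k, by omega, le_rfl, by rw [hk, M.opp_opp]; exact hb⟩
    | succ n ih =>
      obtain ⟨i, hi, hi', hi''⟩ := ih
      obtain ⟨j, hj, hj', hj''⟩ := step i hi''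
      exact ⟨j, by omega, by omega, hj''⟩
  obtain ⟨K, hK⟩ := hL (F.contourLabel r k)
  obtain ⟨i, hi, hi', -⟩ := far K
  exact absurd (hK i hi) (by omega)

end Closure

/-! ### Descending paths in the closure -/

theorem exists_walk_opp (M : CombMap D) (d : D) :
    ∃ w : M.graph.Walk (M.vert d) (M.vert (M.opp d)), w.length ≤ 1 := by
  by_cases h : M.vert d = M.vert (M.opp d)
  · rw [← h]; exact ⟨.nil, by simp⟩
  · exact ⟨.cons (by rw [graph, SimpleGraph.fromRel_adj]; exact ⟨h, .inl ⟨d, rfl, rfl⟩⟩) .nil,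
      by simp⟩

section Descent

variable {F M : CombMap D} {r : D} {A : Set D}

/-- In the complete closure, every proper corner has a neighbour at the first later corner whose
label is one less. -/
theorem PartialClosure.exists_firstDrop (hA : PartialClosure F r M A)
    (hM : ∀ b, ¬ M.IsBlossom b) {k : ℕ} (hk : ¬ F.IsBlossom (F.contour r k)) :
    ∃ k', FirstDrop (F.contourLabel r) k k' ∧
      ∃ w : M.graph.Walk (M.vert (F.contour r k)) (M.vert (F.contour r k')), w.length ≤ 1 := by
  obtain ⟨k', hk', h⟩ : ∃ k', FirstDrop (F.contourLabel r) k k' ∧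
      M.rot.SameCycle (F.opp (F.contour r k)) (F.contour r k') := by
    by_cases hs : F.IsBlossom (F.opp (F.contour r k))
    · exact hA.closed_stem k hs (hM _)
    · refine ⟨k + 1, ⟨by omega, contourLabel_succ_of_proper ⟨hk, hs⟩, by omega⟩, ?_⟩
      rw [contour_succ]
      exact hA.sameCycle _ _ ⟨1, by simp [next_apply]⟩
  refine ⟨k', hk', ?_⟩
  rw [← vert_eq_iff.2 h, ← hA.opp_eq]
  exact exists_walk_opp M _

/-- Following the first drops, one reaches the first later corner of any lower label. -/
theorem PartialClosure.exists_descent (hA : PartialClosure F r M A)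
    (hM : ∀ b, ¬ M.IsBlossom b) {t : ℕ} :
    ∀ (n k : ℕ), ¬ F.IsBlossom (F.contour r k) → k ≤ t →
      F.contourLabel r k = F.contourLabel r t + n →
      (∀ j, k ≤ j → j < t → F.contourLabel r t < F.contourLabel r j) →
      ∃ w : M.graph.Walk (M.vert (F.contour r k)) (M.vert (F.contour r t)), w.length ≤ n := by
  intro n
  induction n with
  | zero =>
    intro k _ hkt hl hj
    obtain rfl : k = t := by
      by_contra hne
      have := hj k le_rfl (by omega)
      omega
    exact ⟨.nil, by simp⟩
  | succ n ih =>
    intro k hk hkt hl hj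
    obtain ⟨k', hk', w, hw⟩ := hA.exists_firstDrop hM hk
    have hlt := hk'.lt
    have heq := hk'.label_eq
    have hk't : k' ≤ t := by
      by_contra hc
      rcases hkt.eq_or_lt with rfl | hlt'
      · push_cast at hl; omega
      · have := hk'.le_label t hlt' (by omega)
        push_cast at hl; omega
    obtain ⟨w', hw'⟩ := ih k' hk'.not_isBlossom hk't (by push_cast at hl; omega)
      (fun j h1 h2 => hj j (by omega) h2)
    exact ⟨w.append w', by rw [SimpleGraph.Walk.length_append]; omega⟩

/-- The descending paths from two corners meet as soon as they are below all the labels between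
these corners. -/
theorem PartialClosure.dist_le (hA : PartialClosure F r M A) (hM : ∀ b, ¬ M.IsBlossom b)
    (hL : ∀ B, ∃ K, ∀ k, K ≤ k → F.contourLabel r k < B) {k l : ℕ} (hkl : k ≤ l)
    (hk : ¬ F.IsBlossom (F.contour r k)) (hl : ¬ F.IsBlossom (F.contour r l)) {m : ℤ}
    (hm : ∀ i, k ≤ i → i ≤ l → m ≤ F.contourLabel r i) :
    M.graph.Reachable (M.vert (F.contour r k)) (M.vert (F.contour r l)) ∧
      (M.graph.dist (M.vert (F.contour r k)) (M.vert (F.contour r l)) : ℤ) ≤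
        F.contourLabel r k + F.contourLabel r l - 2 * m + 2 := by
  classical
  have hex : ∃ t, l ≤ t ∧ F.contourLabel r t < m := by
    obtain ⟨K, hK⟩ := hL m
    exact ⟨max K l, le_max_right _ _, hK _ (le_max_left _ _)⟩
  obtain ⟨t, ⟨hlt, htm⟩, hmin⟩ : ∃ t, (l ≤ t ∧ F.contourLabel r t < m) ∧
      ∀ j, j < t → ¬ (l ≤ j ∧ F.contourLabel r j < m) :=
    ⟨Nat.find hex, Nat.find_spec hex, fun j hj => Nat.find_min hex hj⟩
  have hbelow : ∀ j, k ≤ j → j < t → m ≤ F.contourLabel r j := by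
    intro j hj hjt
    rcases le_or_gt j l with h | h
    · exact hm j hj h
    · exact not_lt.1 fun hc => hmin j hjt ⟨h.le, hc⟩
  have hkm := hm k le_rfl hkl
  have hlm := hm l hkl le_rfl
  have ht : F.contourLabel r t = m - 1 := by
    obtain ⟨s, rfl⟩ : ∃ s, t = s + 1 := by
      refine ⟨t - 1, ?_⟩
      have : t ≠ l := by rintro rfl; omega
      omega
    have hsl : l ≤ s := by
      have : s + 1 ≠ l := by rintro rfl; omega
      omega
    have := hbelow s (by omega) (by omega)
    have := contourLabel_sub_one_le_succ F r s
    omega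
  obtain ⟨w, hw⟩ := hA.exists_descent hM (t := t) (F.contourLabel r k - (m - 1)).toNat k hk
    (by omega) (by omega) (fun j h1 h2 => by have := hbelow j h1 h2; omega)
  obtain ⟨w', hw'⟩ := hA.exists_descent hM (t := t) (F.contourLabel r l - (m - 1)).toNat l hl
    (by omega) (by omega) (fun j h1 h2 => by have := hbelow j (by omega) h2; omega)
  have hd := SimpleGraph.dist_le (w.append w'.reverse)
  rw [SimpleGraph.Walk.length_append, SimpleGraph.Walk.length_reverse] at hd
  exact ⟨(w.append w'.reverse).reachable, by omega⟩

end Descent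

/-! ### The contour of a blossoming forest -/

theorem eq_or_eq_of_sameCycle [Finite D] {σ : Equiv.Perm D} {x y z : D} (hxy : σ x = y)
    (hyx : σ y = x) (h : σ.SameCycle x z) : z = x ∨ z = y := by
  obtain ⟨n, rfl⟩ := h.exists_nat_pow_eq
  induction n with
  | zero => exact .inl rfl
  | succ n ih =>
    rw [pow_succ', Equiv.Perm.mul_apply]
    rcases ih ⟨n, by simp⟩ with h | h <;> rw [h]
    exacts [.inr hxy, .inl hyx]

section Forest

variable [Fintype D] {F : CombMap D} {r : D} {p : ℕ}

/-- Blossoms are not on the root face: otherwise, its boundary being simple, it would consist of a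
single stem, and its length would be less than three. -/
theorem IsBlossomingForest.face_ne_of_isBlossom (hF : F.IsBlossomingForest r p) {b : D}
    (hb : F.IsBlossom b) : F.face b ≠ F.face r := by
  classical
  intro hbr
  have hob : F.face (F.opp b) = F.face r := by rw [← face_next, hb.next_opp, hbr]
  have hnb : F.next b = F.opp b := hF.forest.simple_boundary _ _ (by rw [face_next, hbr]) hob
    (vert_rot F (F.opp b))
  have hsub : {d | F.face d = F.face r} ⊆ (({b, F.opp b} : Finset D) : Set D) := by
    intro d hd
    have := eq_or_eq_of_sameCycle hnb hb.next_opp (face_eq_iff.1 (hbr.trans hd.symm))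
    simpa using this
  have h1 := Set.ncard_le_ncard hsub
  rw [Set.ncard_coe_finset] at h1
  have h2 : ({d | F.face d = F.face r} : Set D).ncard = p := hF.forest.perimeter
  have h3 := Finset.card_le_two (a := b) (b := F.opp b)
  have := hF.three_le
  omega

theorem IsBlossomingForest.not_isBlossom_root (hF : F.IsBlossomingForest r p) :
    ¬ F.IsBlossom r := fun h => hF.face_ne_of_isBlossom h rfl

theorem IsBlossomingForest.face_rot_ne (hF : F.IsBlossomingForest r p) :
    F.face (F.rot r) ≠ F.face r := fun h =>
  hF.not_isBlossom_root (hF.forest.simple_boundary _ _ h rfl (vert_rot F r))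

theorem IsBlossomingForest.face_eq_of_ne (hF : F.IsBlossomingForest r p) {d : D}
    (hd : F.face d ≠ F.face r) : F.face d = F.face (F.rot r) := by
  obtain ⟨x, y, -, hxy⟩ := Nat.card_eq_two_iff.1 hF.forest.two_faces
  have hmem : ∀ z : F.Face, z = x ∨ z = y := fun z => by
    have : z ∈ ({x, y} : Set F.Face) := hxy ▸ Set.mem_univ z
    simpa using this
  have h := hF.face_rot_ne
  rcases hmem (F.face d) with h1 | h1 <;> rcases hmem (F.face r) with h2 | h2 <;>
    rcases hmem (F.face (F.rot r)) with h3 | h3 <;> simp_all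

/-- If both ends of an edge had degree one, this edge alone would bound the non-root face, which
however contains a proper corner, the one that follows the root corner. -/
theorem IsBlossomingForest.not_isBlossom_opp (hF : F.IsBlossomingForest r p) {b : D}
    (hb : F.IsBlossom b) : ¬ F.IsBlossom (F.opp b) := by
  intro hb'
  have h := face_eq_iff.1 (hF.face_eq_of_ne (hF.face_ne_of_isBlossom hb))
  have h0 : ¬ F.IsBlossom (F.rot r) := fun h => hF.not_isBlossom_root (isBlossom_rot_iff.1 h)
  rcases eq_or_eq_of_sameCycle (σ := F.next) hb' hb.next_opp h with h | h
  · exact h0 (h ▸ hb)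
  · exact h0 (h ▸ hb')

theorem IsBlossomingForest.face_contour_ne (hF : F.IsBlossomingForest r p) (k : ℕ) :
    F.face (F.contour r k) ≠ F.face r := by
  induction k with
  | zero => exact hF.face_rot_ne
  | succ k ih => rwa [contour_succ, face_next]

theorem IsBlossomingForest.exists_contour_eq (hF : F.IsBlossomingForest r p) {d : D}
    (hd : F.face d ≠ F.face r) : ∃ k, F.contour r k = d :=
  (face_eq_iff.1 (hF.face_eq_of_ne hd).symm).exists_nat_pow_eq

/-- The contour is periodic, of period `contourLength`, and visits each corner of the non-root face
once in a period. -/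
theorem IsBlossomingForest.contour_period (hF : F.IsBlossomingForest r p) :
    0 < F.contourLength r ∧ (∀ k, F.contour r (k + F.contourLength r) = F.contour r k) ∧
      Set.BijOn (F.contour r) (Set.Iio (F.contourLength r)) {d | F.face d ≠ F.face r} := by
  have hc : ∀ k, F.contour r k = F.next^[k] (F.rot r) := fun k => by
    rw [contour, Equiv.Perm.iterate_eq_pow]
  have hper : F.rot r ∈ Function.periodicPts F.next :=
    F.next.injective.mem_periodicPts _
  have hpos := Function.minimalPeriod_pos_of_mem_periodicPts hper
  have hbij : Set.BijOn (F.contour r) (Set.Iio (Function.minimalPeriod F.next (F.rot r)))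
      {d | F.face d ≠ F.face r} := by
    refine ⟨fun k _ => hF.face_contour_ne k, ?_, ?_⟩
    · intro i hi j hj hij
      rw [hc, hc] at hij
      exact Function.iterate_injOn_Iio_minimalPeriod hi hj hij
    · intro d hd
      obtain ⟨k, rfl⟩ := hF.exists_contour_eq hd
      exact ⟨k % _, Nat.mod_lt _ hpos, by rw [hc, hc, Function.iterate_mod_minimalPeriod_eq]⟩
  have hN : F.contourLength r = Function.minimalPeriod F.next (F.rot r) := by
    have h1 : F.contourLength r = ({d | F.face d ≠ F.face r} : Set D).ncard := rfl
    rw [h1, ← hbij.image_eq, hbij.injOn.ncard_image, ← Finset.coe_Iio, Set.ncard_coe_finset,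
      Nat.card_Iio]
  rw [hN]
  refine ⟨hpos, fun k => ?_, hbij⟩
  rw [hc, hc, Function.iterate_add_minimalPeriod_eq]

theorem IsBlossomingForest.position_spec (hF : F.IsBlossomingForest r p) {d : D}
    (hd : F.face d ≠ F.face r) :
    F.position r d < F.contourLength r ∧ F.contour r (F.position r d) = d := by
  obtain ⟨i, hi, hid⟩ := hF.contour_period.2.2.surjOn hd
  exact ⟨(Nat.sInf_le hid).trans_lt hi, Nat.sInf_mem (s := {i | F.contour r i = d}) ⟨i, hid⟩⟩

/-! ### The labels drop by three in each turn -/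

theorem card_eq_two_mul_card_edge (F : CombMap D) : Nat.card D = 2 * Nat.card F.Edge := by
  classical
  let π : D → F.Edge := Quotient.mk (Equiv.Perm.SameCycle.setoid F.opp)
  have hπ : Function.Surjective π := Quotient.mk_surjective
  have : Finite F.Edge := Finite.of_surjective π hπ
  have := Fintype.ofFinite F.Edge
  have hfib : ∀ x ∈ (Finset.univ : Finset F.Edge),
      ((Finset.univ : Finset D).filter fun d => π d = x).card = 2 := by
    intro x _
    obtain ⟨d, rfl⟩ := hπ x
    have : (Finset.univ.filter fun d' => π d' = π d) = {d, F.opp d} := by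
      ext d'
      simp only [Finset.mem_filter, Finset.mem_univ, true_and, Finset.mem_insert,
        Finset.mem_singleton]
      have hiff : π d' = π d ↔ F.opp.SameCycle d' d := Quotient.eq (r := _)
      rw [hiff]
      refine ⟨fun h => eq_or_eq_of_sameCycle rfl (F.opp_opp d) h.symm, ?_⟩
      rintro (rfl | rfl)
      · exact .refl _ _
      · exact Equiv.Perm.sameCycle_apply_left.2 (.refl _ _)
    rw [this, Finset.card_pair (F.opp_ne d).symm]
  rw [Nat.card_eq_fintype_card, Nat.card_eq_fintype_card, ← Finset.card_univ,
    Finset.card_eq_sum_card_fiberwise (f := π) (t := Finset.univ) (fun _ _ => by simp),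
    Finset.sum_congr rfl hfib]
  simp [mul_comm]

open Classical in
/-- Euler's formula counts the blossoms against the darts: with `n` proper vertices off the root
face there are `B = p - 3 + 2 n` blossoms and `B + p + n` vertices, hence as many edges. -/
theorem IsBlossomingForest.card_isBlossom (hF : F.IsBlossomingForest r p) :
    3 * ((Finset.univ.filter fun d => F.IsBlossom d).card : ℤ) + p + 3 = Fintype.card D := by
  have hsurj : Function.Surjective F.vert := Quotient.mk_surjective
  have : Finite F.Vertex := Finite.of_surjective _ hsurj
  have := Fintype.ofFinite F.Vertex
  have hE := card_eq_two_mul_card_edge F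
  have hEuler := hF.forest.planar.euler
  rw [hF.forest.two_faces] at hEuler
  rw [Nat.card_eq_fintype_card] at hE
  set B : Finset D := Finset.univ.filter fun d => F.IsBlossom d with hB
  set R : Finset D := Finset.univ.filter fun d => F.face d = F.face r with hR
  set I : Finset F.Vertex := Finset.univ.filter fun v =>
    ¬ F.OnRootFace r v ∧ ∀ d, F.vert d = v → ¬ F.IsBlossom d with hI
  have hRp : R.card = p := by
    rw [← hF.forest.perimeter, Nat.card_eq_fintype_card, Fintype.card_subtype]
  have hnot : ∀ b, F.IsBlossom b → ¬ F.OnRootFace r (F.vert b) := by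
    rintro b hb ⟨d, hd, hdb⟩
    rw [← hb.eq_of_vert_eq hdb.symm] at hd
    exact hF.face_ne_of_isBlossom hb hd
  have hV : Nat.card F.Vertex = B.card + p + I.card := by
    have hBi : (B.image F.vert).card = B.card := by
      refine Finset.card_image_of_injOn fun b hb b' _ h => ?_
      exact IsBlossom.eq_of_vert_eq (by simpa [hB] using hb) h
    have hRi : (R.image F.vert).card = p := by
      rw [← hRp]
      refine Finset.card_image_of_injOn fun d hd d' hd' h => ?_
      exact hF.forest.simple_boundary d d' (by simpa [hR] using hd) (by simpa [hR] using hd') h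
    have hd1 : Disjoint (B.image F.vert) (R.image F.vert) := by
      rw [Finset.disjoint_left]
      intro v hv hv'
      simp only [hB, hR, Finset.mem_image, Finset.mem_filter, Finset.mem_univ, true_and] at hv hv'
      obtain ⟨b, hb, rfl⟩ := hv
      exact hnot b hb hv'
    have hd2 : Disjoint (B.image F.vert ∪ R.image F.vert) I := by
      rw [Finset.disjoint_left]
      intro v hv hv'
      simp only [hB, hR, hI, Finset.mem_union, Finset.mem_image, Finset.mem_filter,
        Finset.mem_univ, true_and] at hv hv'
      rcases hv with ⟨b, hb, hbv⟩ | hv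
      · exact hv'.2 b hbv hb
      · exact hv'.1 hv
    have hun : (B.image F.vert ∪ R.image F.vert) ∪ I = Finset.univ := by
      ext v
      simp only [hB, hR, hI, Finset.mem_union, Finset.mem_image, Finset.mem_filter,
        Finset.mem_univ, true_and, iff_true]
      by_cases h1 : F.OnRootFace r v
      · exact .inl (.inr h1)
      by_cases h2 : ∃ d, F.IsBlossom d ∧ F.vert d = v
      · exact .inl (.inl h2)
      · exact .inr ⟨h1, fun d hd hb => h2 ⟨d, hb, hd⟩⟩
    rw [Nat.card_eq_fintype_card, ← Finset.card_univ, ← hun, Finset.card_union_of_disjoint hd2,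
      Finset.card_union_of_disjoint hd1, hBi, hRi]
  have hBc : B.card = (p - 3) + 2 * I.card := by
    rw [← Finset.card_filter_add_card_filter_not (s := B)
      (fun b => F.OnRootFace r (F.vert (F.opp b)))]
    congr 1
    · rw [← hF.root_stems, Nat.card_eq_fintype_card, Fintype.card_subtype, hB,
        Finset.filter_filter]
    · rw [Finset.card_eq_sum_card_fiberwise (f := fun b => F.vert (F.opp b)) (t := I),
        Finset.sum_const_nat (m := 2), mul_comm]
      · intro v hv
        simp only [hI, Finset.mem_filter, Finset.mem_univ, true_and] at hv
        obtain ⟨d, rfl⟩ := hsurj v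
        rw [← hF.inner_stems d (hv.2 d rfl) hv.1, Nat.card_eq_fintype_card, Fintype.card_subtype]
        refine Finset.card_nbij' F.opp F.opp ?_ ?_ (fun x _ => F.opp_opp x)
          (fun x _ => F.opp_opp x)
        · intro b hb
          simp only [hB, Finset.coe_filter, Set.mem_ofPred_eq, Finset.mem_filter,
            Finset.mem_univ, true_and, F.opp_opp] at hb ⊢
          exact ⟨hb.2, hb.1.1⟩
        · intro s hs
          simp only [hB, Finset.coe_filter, Set.mem_ofPred_eq, Finset.mem_filter,
            Finset.mem_univ, true_and, F.opp_opp] at hs ⊢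
          exact ⟨⟨hs.2, by rw [hs.1]; exact hv.1⟩, hs.1⟩
      · intro b hb
        simp only [hB, hI, Finset.coe_filter, Set.mem_ofPred_eq, Finset.mem_filter,
          Finset.mem_univ, true_and] at hb ⊢
        refine ⟨hb.2, fun d hd hdb => ?_⟩
        rw [hdb.eq_of_vert_eq hd] at hdb
        exact hF.not_isBlossom_opp hb.1 hdb
  have := hF.three_le
  omega

open Classical in
theorem IsBlossomingForest.sum_labelStep (hF : F.IsBlossomingForest r p) :
    ∑ d with F.face d ≠ F.face r, F.labelStep d = -3 := by
  have hstep : ∀ d, F.labelStep d =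
      2 * (if F.IsBlossom d then 1 else 0) + (if F.IsBlossom (F.opp d) then 1 else 0) - 1 := by
    intro d
    unfold labelStep
    by_cases h : F.IsBlossom d
    · simp [h, hF.not_isBlossom_opp h]
    · by_cases h' : F.IsBlossom (F.opp d) <;> simp [h, h']
  have hB := hF.card_isBlossom
  have hR : (Finset.univ.filter fun d => F.face d = F.face r).card = p := by
    rw [← hF.forest.perimeter, Nat.card_eq_fintype_card, Fintype.card_subtype]
  have hRc := Finset.card_filter_add_card_filter_not (s := (Finset.univ : Finset D))
    (fun d => F.face d = F.face r)
  rw [hR, Finset.card_univ] at hRc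
  have h1 : (Finset.univ.filter fun d => F.face d ≠ F.face r).filter (fun d => F.IsBlossom d) =
      Finset.univ.filter fun d => F.IsBlossom d := by
    ext d
    simpa using fun h => hF.face_ne_of_isBlossom h
  have h2 : ((Finset.univ.filter fun d => F.face d ≠ F.face r).filter
      (fun d => F.IsBlossom (F.opp d))).card =
        (Finset.univ.filter fun d => F.IsBlossom d).card := by
    refine Finset.card_nbij' F.opp F.opp ?_ ?_ (fun x _ => F.opp_opp x) (fun x _ => F.opp_opp x)
    · intro d hd
      simpa using (Finset.mem_filter.1 hd).2
    · intro b hb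
      have hb : F.IsBlossom b := by simpa using hb
      simpa [F.opp_opp, hb, hb.face_opp] using hF.face_ne_of_isBlossom hb
  simp_rw [hstep]
  rw [Finset.sum_sub_distrib, Finset.sum_add_distrib, ← Finset.mul_sum, Finset.sum_boole,
    Finset.sum_boole, h1, h2, Finset.sum_const, nsmul_eq_mul, mul_one]
  simp only [ne_eq] at *
  omega

theorem IsBlossomingForest.contourLabel_add_period (hF : F.IsBlossomingForest r p) (k : ℕ) :
    F.contourLabel r (k + F.contourLength r) = F.contourLabel r k - 3 := by
  classical
  obtain ⟨-, hper, hbij⟩ := hF.contour_period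
  induction k with
  | zero =>
    have hsum : ∀ n, F.contourLabel r n = ∑ i ∈ Finset.range n, F.labelStep (F.contour r i) := by
      intro n
      induction n with
      | zero => rfl
      | succ n ih => rw [contourLabel_succ, ih, Finset.sum_range_succ]
    rw [zero_add, hsum, show F.contourLabel r 0 = 0 from rfl, zero_sub, ← hF.sum_labelStep]
    refine Finset.sum_nbij (F.contour r) ?_ ?_ ?_ (fun _ _ => rfl)
    · intro i hi
      simpa using hF.face_contour_ne i
    · intro i hi j hj h
      exact hbij.injOn (by simpa using hi) (by simpa using hj) h
    · intro d hd
      obtain ⟨i, hi, hid⟩ := hbij.surjOn (show d ∈ _ by simpa using hd)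
      exact ⟨i, by simpa using hi, hid⟩
  | succ k ih =>
    rw [Nat.add_right_comm, contourLabel_succ, hper, ih, contourLabel_succ]
    ring

theorem IsBlossomingForest.exists_contourLabel_lt (hF : F.IsBlossomingForest r p) (B : ℤ) :
    ∃ K, ∀ k, K ≤ k → F.contourLabel r k < B := by
  have hpos := hF.contour_period.1
  have hle : ∀ k, F.contourLabel r k ≤ F.contourLength r - k / F.contourLength r * 3 := by
    intro k
    induction k using Nat.strong_induction_on with
    | _ k ih =>
      rcases lt_or_ge k (F.contourLength r) with h | h
      · have hk : ∀ n, F.contourLabel r n ≤ n := by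
          intro n
          induction n with
          | zero => rfl
          | succ n ih =>
            simp only [contourLabel]
            push_cast
            split_ifs <;> omega
        have := hk k
        rw [Int.ediv_eq_zero_of_lt (by omega) (by omega)]
        omega
      · obtain ⟨j, rfl⟩ := Nat.exists_eq_add_of_le' h
        rw [hF.contourLabel_add_period]
        have := ih j (by omega)
        push_cast
        rw [Int.add_ediv_of_dvd_right (dvd_refl _), Int.ediv_self (by omega)]
        omega
  refine ⟨F.contourLength r * (F.contourLength r + B.natAbs + 1), fun k hk => ?_⟩
  have h1 := hle k
  have h2 : (F.contourLength r + B.natAbs + 1 : ℤ) ≤ k / F.contourLength r := by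
    rw [Int.le_ediv_iff_mul_le (by omega), mul_comm]
    exact_mod_cast hk
  omega

/-! ### Distances in the closure of a blossoming forest -/

/-- An oriented dart emanates from a proper corner of the contoured face. -/
theorem IsBlossomingForest.of_oriented (hF : F.IsBlossomingForest r p) {e : D}
    (he : F.Oriented r e) : F.face e ≠ F.face r ∧ ¬ F.IsBlossom e := by
  rcases he with he | he | he
  · have hne : F.face e ≠ F.face r := by
      intro h
      have h1 : F.next e = F.opp e := hF.forest.simple_boundary _ _ (by rw [face_next, h]) he
        (vert_rot F (F.opp e))
      exact hF.face_ne_of_isBlossom (b := F.opp e) h1 he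
    exact ⟨hne, fun hb => hne (by rw [← hb.face_opp, he])⟩
  · exact ⟨he.1, he.2.2.1.1⟩
  · have h := he.face_opp
    have h' := hF.not_isBlossom_opp he
    rw [F.opp_opp] at h h'
    exact ⟨h ▸ hF.face_ne_of_isBlossom he, h'⟩

theorem IsBlossomingForest.minLabel_le (hF : F.IsBlossomingForest r p) {e f : D}
    (he : F.face e ≠ F.face r)
    (hf : F.face f ≠ F.face r) {i : ℕ} (hi : i ∈ F.cyclicInterval r e f) :
    F.minLabel r e f ≤ F.contourLabel r i := by
  have hfin : (F.cyclicInterval r e f).Finite := by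
    refine (Set.finite_Iic (F.contourLength r)).subset fun i hi => ?_
    have := (hF.position_spec he).1
    have := (hF.position_spec hf).1
    simp only [cyclicInterval, Set.mem_ofPred_eq] at hi
    simp only [Set.mem_Iic]
    omega
  exact csInf_le (hfin.image _).bddBelow ⟨i, hi, rfl⟩

/-- The bound for one of the two cyclic intervals between two corners. When the interval goes past
the end of the contour, its second part is shifted by one period, in which all the labels are less
by three; this costs the three units beyond `2`. -/
theorem IsBlossomingForest.dist_le_minLabel [DecidableEq D] (hF : F.IsBlossomingForest r p)
    {M : CombMap D} (hM : F.IsClosure M) {e f : D} (he : F.Oriented r e) (hf : F.Oriented r f) :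
    M.graph.Reachable (M.vert e) (M.vert f) ∧
      (M.graph.dist (M.vert e) (M.vert f) : ℤ) ≤
        F.cornerLabel r e + F.cornerLabel r f - 2 * F.minLabel r e f + 5 := by
  obtain ⟨he, hbe⟩ := hF.of_oriented he
  obtain ⟨hf, hbf⟩ := hF.of_oriented hf
  have hopp : ∀ b, F.IsBlossom b → ¬ F.IsBlossom (F.opp b) := fun b => hF.not_isBlossom_opp
  have hL := hF.exists_contourLabel_lt
  obtain ⟨A, hA⟩ := (PartialClosure.refl
    (fun d hd => hF.exists_contour_eq (hF.face_ne_of_isBlossom hd))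
    (fun d hd => hF.exists_contour_eq (by
      have := hd.face_opp
      rw [F.opp_opp] at this
      exact this ▸ hF.face_ne_of_isBlossom hd))).of_reflTransGen hopp hM.1
  have hMb := hA.not_isBlossom hopp hM.2 hL
  obtain ⟨hie, hce⟩ := hF.position_spec he
  obtain ⟨hif, hcf⟩ := hF.position_spec hf
  have hmin := fun i => hF.minLabel_le he hf (i := i)
  simp only [cornerLabel]
  simp only [cyclicInterval, Set.mem_ofPred_eq] at hmin
  rcases le_or_gt (F.position r e) (F.position r f) with h | h
  · have := hA.dist_le hMb hL h (by rwa [hce]) (by rwa [hcf]) (m := F.minLabel r e f)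
      (fun i h1 h2 => hmin i (by omega))
    rw [hce, hcf] at this
    exact ⟨this.1, by omega⟩
  · have hper := hF.contour_period.2.1 (F.position r f)
    have hlab := hF.contourLabel_add_period (F.position r f)
    have := hA.dist_le hMb hL (k := F.position r e) (l := F.position r f + F.contourLength r)
      (by omega) (by rwa [hce]) (by rwa [hper, hcf]) (m := F.minLabel r e f - 3)
      (fun i h1 h2 => by
        rcases le_or_gt i (F.contourLength r) with h3 | h3
        · have := hmin i (by omega)
          omega
        · obtain ⟨j, rfl⟩ := Nat.exists_eq_add_of_le' h3.le
          have := hmin j (by omega)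
          rw [hF.contourLabel_add_period]
          omega)
    rw [hper, hce, hcf, hlab] at this
    exact ⟨this.1, by omega⟩

end Forest

end CombMap

/-- `F` is a blossoming forest with root corner `κ^ℓ(r)` and `M` is its closure, which has the same
darts as `F`; the vertex `M.vert e` of `M` is identified with the proper vertex `F.vert e` of `F`. -/
theorem proposition5 {D : Type*} [Fintype D] [DecidableEq D] (p : ℕ) (F : CombMap D) (r : D)
    (hF : F.IsBlossomingForest r p) (M : CombMap D) (hM : F.IsClosure M)
    (u v : M.Vertex) (e f : D) (hu : M.vert e = u) (hv : M.vert f = v)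
    (he : F.Oriented r e) (hf : F.Oriented r f)
    (hXu : F.cornerLabel r e = F.vertexLabel r (F.vert e))
    (hXv : F.cornerLabel r f = F.vertexLabel r (F.vert f)) :
    M.graph.Reachable u v ∧
      (M.graph.dist u v : ℤ) ≤
        F.vertexLabel r (F.vert e) + F.vertexLabel r (F.vert f)
          - 2 * max (F.minLabel r e f) (F.minLabel r f e) + 6 := by
  subst hu hv
  obtain ⟨h1, h2⟩ := hF.dist_le_minLabel hM he hf
  obtain ⟨-, h3⟩ := hF.dist_le_minLabel hM hf he
  rw [SimpleGraph.dist_comm] at h3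
  rw [← hXu, ← hXv]
  refine ⟨h1, ?_⟩
  rcases max_choice (F.minLabel r e f) (F.minLabel r f e) with h | h <;> rw [h] <;> omega
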